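/- Let $X$, $Y$, $Z$ be Banach spaces over $\mathbb K$ ($\mathbb K=\mathbb R$ or $\mathbb C$), with $Y$ a subspace of $Z$, let $1\le p\le\infty$, and let $q$ be the conjugate exponent, $\frac1p+\frac1q=1$. Definitions. For a Banach space $E$ let $\ell_p^s(E)$ be the space of sequences $(x_n)$ in $E$ with $\|(x_n)\|_p^s=\big(\sum_n\|x_n\|^p\big)^{1/p}<\infty$ if $p<\infty$, and the space of norm-null sequences in $E$ with $\|(x_n)\|_\infty^s=\sup_n\|x_n\|$ if $p=\infty$. For $x=(x_n)\in\ell_p^s(E)$ define $E_x:\ell_q\to E$ by $E_x(\alpha)=\sum_n\alpha_nx_n$. A bounded linear operator $S:F\to E$ is $p$-compact, $S\in K_p(F,E)$, if there is $x\in\ell_p^s(E)$ with $S(B_F)\subseteq E_x(B_{\ell_q})$, where $B$ denotes closed unit balls, and then $\kappa_p(S)$ is the infimum of $\|x\|_p^s$ over all such $x$. A bounded linear operator $S:F\to E$ belongs to the dual ideal $K_p^d(F,E)$ if its adjoint $S^*:E^*\to F^*$ is $p$-compact, and then $\kappa_p^d(S)=\kappa_p(S^*)$. For $\lambda\ge1$,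 a Banach space $X$ is a $P_\lambda$-space if for every Banach space $W\supseteq X$ there is a projection of $W$ onto $X$ of norm at most $\lambda$. Theorem. Let $\lambda\ge 1$, let $X$ be a $P_\lambda$-space and let $T\in K_p^d(Y,X)$. Then for every $\varepsilon>0$ there is $\widetilde T\in K_p^d(Z,X)$ with $\widetilde T|_Y=T$ and $$\kappa_p^d(\widetilde T)\le(\lambda+\varepsilon)\,\kappa_p^d(T).$$ -/

import Mathlib

open scoped ENNReal Topology

universe u v

/-- The space `ℓ_p^s(X)` of strongly `p`-summable sequences for `1 ≤ p < ∞`; for `p = ∞` the space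
`c₀(X)` of null sequences with the supremum norm. In both cases the norm is that of Mathlib's `lp`:
`(∑ ‖x_n‖ ^ p) ^ (1 / p)`, respectively `sup ‖x_n‖`. -/
def StrongSeq (X : Type*) [NormedAddCommGroup X] (p : ℝ≥0∞) : Set (lp (fun _ : ℕ => X) p) :=
  {x | p = ∞ → Filter.Tendsto (fun n => x n) Filter.atTop (𝓝 0)}

/-- The set `E_x(B_{ℓ_q})`, where `1/p + 1/q = 1`, `B_{ℓ_q}` is the closed unit ball of the scalar
space `ℓ_q`, and `E_x(α) = ∑ α_n x_n`. -/
def ballImage (𝕜 : Type*) [RCLike 𝕜] {X : Type*} [NormedAddCommGroup X] [NormedSpace 𝕜 X]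
    (p : ℝ≥0∞) (x : lp (fun _ : ℕ => X) p) : Set X :=
  {z | ∃ α : lp (fun _ : ℕ => 𝕜) p.conjExponent, ‖α‖ ≤ 1 ∧ HasSum (fun n => α n • x n) z}

/-- Relatively `p`-compact sets. -/
def IsRelPCompact (𝕜 : Type*) [RCLike 𝕜] {X : Type*} [NormedAddCommGroup X] [NormedSpace 𝕜 X]
    (p : ℝ≥0∞) (K : Set X) : Prop :=
  ∃ x ∈ StrongSeq X p, K ⊆ ballImage 𝕜 p x

section Operators

variable {𝕜 : Type*} [RCLike 𝕜]
  {X : Type*} [NormedAddCommGroup X] [NormedSpace 𝕜 X]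
  {Y : Type*} [NormedAddCommGroup Y] [NormedSpace 𝕜 Y]

/-- `T ∈ K_p(X, Y)`: `T` maps the closed unit ball (equivalently, by scaling, every bounded set) to
a relatively `p`-compact set. -/
def IsPCompactOp (p : ℝ≥0∞) (T : X →L[𝕜] Y) : Prop :=
  IsRelPCompact 𝕜 p (T '' Metric.closedBall 0 1)

/-- The ideal norm `κ_p(T) = inf {‖y‖ : y ∈ ℓ_p^s(Y), T(B_X) ⊆ E_y(B_{ℓ_q})}` (meaningful for
`p`-compact `T`). -/
noncomputable def kappa (p : ℝ≥0∞) (T : X →L[𝕜] Y) : ℝ :=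
  sInf {r : ℝ | ∃ y ∈ StrongSeq Y p, T '' Metric.closedBall 0 1 ⊆ ballImage 𝕜 p y ∧ r = ‖y‖}

/-- The Banach space adjoint `T* : Y* → X*`, `T* f = f ∘ T`. -/
noncomputable def dualOp (T : X →L[𝕜] Y) : StrongDual 𝕜 Y →L[𝕜] StrongDual 𝕜 X :=
  T.precomp 𝕜

/-- Membership in the dual ideal: `T ∈ K_p^d(X, Y)` if and only if `T* ∈ K_p(Y*, X*)`. -/
def IsDualPCompactOp (p : ℝ≥0∞) (T : X →L[𝕜] Y) : Prop :=
  IsPCompactOp p (dualOp T)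

/-- The dual ideal norm `κ_p^d(T) = κ_p(T*)`. -/
noncomputable def kappaDual (p : ℝ≥0∞) (T : X →L[𝕜] Y) : ℝ :=
  kappa p (dualOp T)

end Operators

/-- `X` is a `P_lam`-space: for every Banach space `Z` containing `X` (through a linear isometric
embedding) there is a projection of norm at most `lam` from `Z` onto `X`. The spaces `Z` range over
the least universe that contains the spaces `ℓ_∞(Γ)`, with `Γ` in the universe of `X`; as `X` embeds
in such a space, larger universes give the same notion. -/
def IsPSpace (𝕜 : Type v) [RCLike 𝕜] (lam : ℝ) (X : Type u) [NormedAddCommGroup X]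
    [NormedSpace 𝕜 X] : Prop :=
  ∀ (Z : Type (max u v)) [NormedAddCommGroup Z] [NormedSpace 𝕜 Z] [CompleteSpace Z] (i : X →ₗᵢ[𝕜] Z),
    ∃ P : Z →L[𝕜] X, (∀ x, P (i x) = x) ∧ ‖P‖ ≤ lam

/-!
The extension of `T` is obtained by factoring through `ℓ_p` and `ℓ_∞(Γ)`, where `Γ` is the closed
unit ball of `X*`.

Suppose `T*` maps the unit ball of `X*` into `E_φ(B_{ℓ_q})` with `φ = (φ_n)` in `ℓ_p^s(Y*)`, so that
`f ∘ T = ∑ α^f_n φ_n` with `‖α^f‖ ≤ 1` for every `f ∈ Γ`. By Hahn–Banach each `φ_n` extends to a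
functional `ψ_n` on `Z` of the same norm. Let `U : Z → ℓ_p` send `z` to `(ψ_n z)` (`evalSeq`), and let
`R : ℓ_p → ℓ_∞(Γ)` send `a` to `(∑ α^f_n a_n)_f` (`toLinfty`). On `Y` the composition `R ∘ U` is `T`
followed by the canonical isometric embedding of `X` into `ℓ_∞(Γ)` (`dualBallEmbedding`). The
`P_λ`-property gives a projection `P` of `ℓ_∞(Γ)` onto `X` of norm at most `λ`, and
`T' = P ∘ R ∘ U` extends `T`.

For `f ∈ Γ` the functional `g = f ∘ P ∘ R` on `ℓ_p` has norm at most `λ`; its values `β_n = g(e_n)` on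
the unit vectors form a sequence in `ℓ_q` of norm at most `λ` (`exists_lp_coeff_of_dual`). As `U z` is
the sum of its coordinates in `ℓ_p` (for `p = ∞` because it is a null sequence), `T'* f = ∑ β_n ψ_n`.
So `T'*` maps `Γ` into `E_{λψ}(B_{ℓ_q})`, and `κ_p^d(T') ≤ λ ‖φ‖`
(`exists_extension_of_dualOp_subset_ballImage`). The term `ε` only absorbs the passage from `‖φ‖` to
the infimum; when `κ_p^d(T) = 0`, the operator `T` vanishes and is extended by `0`.
-/

/-! ### Sequence spaces -/

/-- Elements of `ℓ_p`, and null sequences if `p = ∞`, are the sum of their coordinates. -/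
theorem lp_hasSum_single_of_tendsto {E : Type*} [NormedAddCommGroup E] {p : ℝ≥0∞} [Fact (1 ≤ p)]
    (a : lp (fun _ : ℕ => E) p)
    (ha : p = ∞ → Filter.Tendsto (fun n => a n) Filter.atTop (𝓝 0)) :
    HasSum (fun n => (lp.single p n (a n) : lp (fun _ : ℕ => E) p)) a := by
  by_cases hp : p = ∞
  · subst hp
    rw [HasSum, Metric.tendsto_nhds]
    intro ε hε
    obtain ⟨N, hN⟩ := Metric.tendsto_atTop.1 (ha rfl) (ε / 2) (half_pos hε)
    filter_upwards [Filter.eventually_ge_atTop (Finset.range N)] with s hs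
    rw [dist_comm, dist_eq_norm]
    refine lt_of_le_of_lt (lp.norm_le_of_forall_le (half_pos hε).le fun n => ?_) (half_lt_self hε)
    have hn : (a - ∑ i ∈ s, (lp.single ∞ i (a i) : lp (fun _ : ℕ => E) ∞)) n
        = a n - if n ∈ s then a n else 0 := by
      simp only [lp.coeFn_sub, lp.coeFn_sum, lp.coeFn_single, Pi.sub_apply, Finset.sum_apply,
        Finset.sum_pi_single]
    rw [hn]
    by_cases h : n ∈ s
    · simpa [h] using (half_pos hε).le
    · have hNn : N ≤ n := by
        by_contra hlt
        exact h (hs (Finset.mem_range.2 (not_le.1 hlt)))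
      simpa [h] using (hN n hNn).le
  · exact lp.hasSum_single hp a

theorem norm_conj_mul_rpow_sub_two {𝕜 : Type*} [RCLike 𝕜] {b : 𝕜} (hb : b ≠ 0) (q : ℝ) :
    ‖starRingEnd 𝕜 b * ((‖b‖ ^ (q - 2) : ℝ) : 𝕜)‖ = ‖b‖ ^ (q - 1) := by
  have hb' : 0 < ‖b‖ := norm_pos_iff.2 hb
  rw [norm_mul, RCLike.norm_conj, RCLike.norm_ofReal, abs_of_nonneg (by positivity),
    show q - 1 = 1 + (q - 2) by ring, Real.rpow_add hb', Real.rpow_one]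

theorem mul_conj_mul_rpow_sub_two {𝕜 : Type*} [RCLike 𝕜] (b : 𝕜) {q : ℝ} (hq : 0 < q) :
    (starRingEnd 𝕜 b * ((‖b‖ ^ (q - 2) : ℝ) : 𝕜)) * b = ((‖b‖ ^ q : ℝ) : 𝕜) := by
  rcases eq_or_ne b 0 with rfl | hb
  · simp [Real.zero_rpow hq.ne']
  · have hb' : 0 < ‖b‖ := norm_pos_iff.2 hb
    rw [mul_right_comm, RCLike.conj_mul, show q = 2 + (q - 2) by ring, Real.rpow_add hb',
      Real.rpow_two, show 2 + (q - 2) - 2 = q - 2 by ring]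
    push_cast
    ring

/-- The values of a functional on `ℓ_p` at the unit vectors form a sequence in `ℓ_q` whose norm is at
most that of the functional. -/
theorem exists_lp_coeff_of_dual {𝕜 : Type*} [RCLike 𝕜] {p q : ℝ≥0∞} [Fact (1 ≤ p)]
    [hpq : p.HolderConjugate q] (g : StrongDual 𝕜 (lp (fun _ : ℕ => 𝕜) p)) :
    ∃ β : lp (fun _ : ℕ => 𝕜) q, ‖β‖ ≤ ‖g‖ ∧ ∀ n, β n = g (lp.single p n 1) := by
  have hp0 : 0 < p := zero_lt_one.trans_le Fact.out
  have hq1 : 1 ≤ q := hpq.symm.one_le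
  have hbound : ∀ n, ‖g (lp.single p n 1)‖ ≤ ‖g‖ := fun n => by
    simpa [lp.norm_single hp0] using g.le_opNorm (lp.single p n 1)
  rcases eq_or_ne q ∞ with rfl | hq
  · exact ⟨⟨fun n => g (lp.single p n 1), memℓp_infty ⟨‖g‖, by rintro _ ⟨n, rfl⟩; exact hbound n⟩⟩,
      lp.norm_le_of_forall_le (norm_nonneg _) hbound, fun _ => rfl⟩
  have hqpos : 0 < q.toReal := ENNReal.toReal_pos (zero_lt_one.trans_le hq1).ne' hq
  -- Test `g` against the finitely supported sequence that is extremal in Hölder's inequality.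
  have key : ∀ s : Finset ℕ, ∑ n ∈ s, ‖g (lp.single p n 1)‖ ^ q.toReal ≤ ‖g‖ ^ q.toReal := by
    intro s
    set b : ℕ → 𝕜 := fun n => g (lp.single p n 1) with hb
    set c : ℕ → 𝕜 := fun n => starRingEnd 𝕜 (b n) * ((‖b n‖ ^ (q.toReal - 2) : ℝ) : 𝕜) with hc
    set B : ℝ := ∑ n ∈ s, ‖b n‖ ^ q.toReal with hB
    have hB0 : 0 ≤ B := Finset.sum_nonneg fun n _ => by positivity
    set a : lp (fun _ : ℕ => 𝕜) p := ∑ n ∈ s, lp.single p n (c n) with ha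
    have hga : g a = (B : 𝕜) := by
      rw [ha, map_sum, hB, RCLike.ofReal_sum]
      refine Finset.sum_congr rfl fun n _ => ?_
      rw [← mul_conj_mul_rpow_sub_two (b n) hqpos]
      have : (lp.single p n (c n) : lp (fun _ : ℕ => 𝕜) p) = c n • lp.single p n 1 := by
        rw [← lp.single_smul, smul_eq_mul, mul_one]
      rw [this, map_smul, smul_eq_mul]
    have hBg : B ≤ ‖g‖ * ‖a‖ := by
      have := g.le_opNorm a
      rwa [hga, RCLike.norm_ofReal, abs_of_nonneg hB0] at this
    rcases eq_or_ne p ∞ with rfl | hp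
    · have hq1 : q = 1 := ENNReal.HolderConjugate.unique ∞ q 1
      have ha1 : ‖a‖ ≤ 1 := by
        refine lp.norm_le_of_forall_le zero_le_one fun n => ?_
        have hn : a n = if n ∈ s then c n else 0 := by
          simp only [ha, lp.coeFn_sum, lp.coeFn_single, Finset.sum_apply, Finset.sum_pi_single]
        rw [hn]
        split_ifs
        · rcases eq_or_ne (b n) 0 with h0 | h0
          · simp [hc, h0]
          · simp only [hc]
            rw [norm_conj_mul_rpow_sub_two h0]
            simp [hq1]
        · simp
      have hfin : B ≤ ‖g‖ := hBg.trans (mul_le_of_le_one_right (norm_nonneg _) ha1)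
      simpa [hq1] using hfin
    · have hconj : p.toReal.HolderConjugate q.toReal :=
        ENNReal.HolderConjugate.toReal_of_ne_top hp hq
      have hap : ‖a‖ ^ p.toReal = B := by
        rw [ha, lp.norm_sum_single hconj.pos]
        refine Finset.sum_congr rfl fun n _ => ?_
        rcases eq_or_ne (b n) 0 with h0 | h0
        · simp [hc, h0, Real.zero_rpow hconj.pos.ne', Real.zero_rpow hqpos.ne']
        · simp only [hc]
          rw [norm_conj_mul_rpow_sub_two h0, ← Real.rpow_mul (norm_nonneg _),
            hconj.symm.sub_one_mul_conj]
      rcases hB0.eq_or_lt with h0 | hBpos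
      · rw [← h0]; positivity
      have hgp : B ^ p.toReal ≤ ‖g‖ ^ p.toReal * B := by
        rw [← hap, ← Real.mul_rpow (norm_nonneg _) (norm_nonneg _), hap]
        exact Real.rpow_le_rpow hB0 hBg hconj.pos.le
      have h1 : B ^ (p.toReal - 1) ≤ ‖g‖ ^ p.toReal := by
        rw [Real.rpow_sub_one hBpos.ne', div_le_iff₀ hBpos]
        exact hgp
      have h2 := Real.rpow_le_rpow (by positivity) h1 (z := q.toReal - 1) hconj.symm.sub_one_pos.le
      rw [← Real.rpow_mul hB0, ← Real.rpow_mul (norm_nonneg _)] at h2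
      have e1 : (p.toReal - 1) * (q.toReal - 1) = 1 := by
        have := hconj.mul_eq_add
        linear_combination this
      have e2 : p.toReal * (q.toReal - 1) = q.toReal := by
        have := hconj.mul_eq_add
        linear_combination this
      rwa [e1, e2, Real.rpow_one] at h2
  exact ⟨⟨fun n => g (lp.single p n 1), memℓp_gen' key⟩,
    lp.norm_le_of_forall_sum_le hqpos (norm_nonneg _) key, fun _ => rfl⟩

/-! ### Maps into sequence spaces -/

/-- The operator `z ↦ (ψ_n z)` into `ℓ_p` given by a sequence `ψ` in `ℓ_p^s(Z*)`. -/
noncomputable def evalSeq {𝕜 : Type*} [RCLike 𝕜] {Z : Type*} [NormedAddCommGroup Z]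
    [NormedSpace 𝕜 Z] {p : ℝ≥0∞} [Fact (1 ≤ p)] (ψ : lp (fun _ : ℕ => StrongDual 𝕜 Z) p) :
    Z →L[𝕜] lp (fun _ : ℕ => 𝕜) p :=
  LinearMap.mkContinuous
    { toFun z := ⟨fun n => ψ n z, ((lp.memℓp ψ).norm.const_mul ‖z‖).mono fun n => by
        simpa [mul_comm] using (ψ n).le_opNorm z⟩
      map_add' _ _ := by ext; simp; rfl
      map_smul' _ _ := by ext; simp }
    ‖ψ‖ fun z => by
      have h : ‖(z : Z)‖ * ‖ψ‖ = ‖‖z‖ • lp.toNorm ψ‖ := by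
        rw [norm_smul, lp.norm_toNorm, norm_norm]
      rw [mul_comm, h]
      refine lp.norm_mono (zero_lt_one.trans_le Fact.out).ne' fun n => ?_
      simpa [mul_comm] using (ψ n).le_opNorm z

@[simp]
theorem evalSeq_apply {𝕜 : Type*} [RCLike 𝕜] {Z : Type*} [NormedAddCommGroup Z]
    [NormedSpace 𝕜 Z] {p : ℝ≥0∞} [Fact (1 ≤ p)] (ψ : lp (fun _ : ℕ => StrongDual 𝕜 Z) p)
    (z : Z) (n : ℕ) : evalSeq ψ z n = ψ n z :=
  rfl

/-- The operator `x ↦ (g_i x)` into `ℓ_∞(ι)` given by a family of functionals of norm at most `1`. -/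
noncomputable def toLinfty {𝕜 : Type*} [RCLike 𝕜] {E : Type*} [NormedAddCommGroup E]
    [NormedSpace 𝕜 E] {ι : Type*} (g : ι → StrongDual 𝕜 E) (hg : ∀ i, ‖g i‖ ≤ 1) :
    E →L[𝕜] lp (fun _ : ι => 𝕜) ∞ :=
  LinearMap.mkContinuous
    { toFun x := ⟨fun i => g i x, memℓp_infty ⟨‖x‖, by
        rintro _ ⟨i, rfl⟩
        simpa using (g i).le_of_opNorm_le (hg i) x⟩⟩
      map_add' _ _ := by ext; simp; rfl
      map_smul' _ _ := by ext; simp }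
    1 fun x => lp.norm_le_of_forall_le (by positivity) fun i => (g i).le_of_opNorm_le (hg i) x

@[simp]
theorem toLinfty_apply {𝕜 : Type*} [RCLike 𝕜] {E : Type*} [NormedAddCommGroup E]
    [NormedSpace 𝕜 E] {ι : Type*} (g : ι → StrongDual 𝕜 E) (hg : ∀ i, ‖g i‖ ≤ 1) (x : E) (i : ι) :
    toLinfty g hg x i = g i x :=
  rfl

theorem norm_toLinfty_le {𝕜 : Type*} [RCLike 𝕜] {E : Type*} [NormedAddCommGroup E]
    [NormedSpace 𝕜 E] {ι : Type*} (g : ι → StrongDual 𝕜 E) (hg : ∀ i, ‖g i‖ ≤ 1) :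
    ‖toLinfty g hg‖ ≤ 1 :=
  LinearMap.mkContinuous_norm_le _ zero_le_one _

/-- The canonical isometric embedding of a normed space into `ℓ_∞` over the unit ball of its dual. -/
noncomputable def dualBallEmbedding (𝕜 : Type*) [RCLike 𝕜] (X : Type*) [NormedAddCommGroup X]
    [NormedSpace 𝕜 X] :
    X →ₗᵢ[𝕜] lp (fun _ : Metric.closedBall (0 : StrongDual 𝕜 X) 1 => 𝕜) ∞ where
  toLinearMap := (toLinfty (fun f : Metric.closedBall (0 : StrongDual 𝕜 X) 1 => f.1)
    fun f => mem_closedBall_zero_iff.1 f.2).toLinearMap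
  norm_map' x := by
    refine le_antisymm ?_ ?_
    · exact (ContinuousLinearMap.le_of_opNorm_le _ (norm_toLinfty_le _ _) x).trans_eq (one_mul _)
    · obtain ⟨f, hf, hfx⟩ := exists_dual_vector'' 𝕜 x
      have h := lp.norm_apply_le_norm ENNReal.top_ne_zero
        (toLinfty (fun f : Metric.closedBall (0 : StrongDual 𝕜 X) 1 => f.1)
          (fun f => mem_closedBall_zero_iff.1 f.2) x) ⟨f, mem_closedBall_zero_iff.2 hf⟩
      rw [toLinfty_apply] at h
      simpa [hfx] using h

@[simp]
theorem dualBallEmbedding_apply {𝕜 : Type*} [RCLike 𝕜] {X : Type*} [NormedAddCommGroup X]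
    [NormedSpace 𝕜 X] (x : X) (f : Metric.closedBall (0 : StrongDual 𝕜 X) 1) :
    dualBallEmbedding 𝕜 X x f = f.1 x :=
  rfl

/-! ### Strongly summable sequences of functionals -/

theorem StrongSeq.congr_norm {E F : Type*} [NormedAddCommGroup E] [NormedAddCommGroup F] {p : ℝ≥0∞}
    {x : lp (fun _ : ℕ => E) p} {y : lp (fun _ : ℕ => F) p} (hx : x ∈ StrongSeq E p)
    (h : ∀ n, ‖y n‖ = ‖x n‖) : y ∈ StrongSeq F p := fun hp =>
  tendsto_zero_iff_norm_tendsto_zero.2 <| by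
    simpa only [h] using tendsto_zero_iff_norm_tendsto_zero.1 (hx hp)

theorem StrongSeq.const_smul {𝕜 E : Type*} [RCLike 𝕜] [NormedAddCommGroup E] [NormedSpace 𝕜 E]
    {p : ℝ≥0∞} {x : lp (fun _ : ℕ => E) p} (hx : x ∈ StrongSeq E p) (c : 𝕜) :
    c • x ∈ StrongSeq E p := fun hp => by
  simpa only [smul_zero] using! Filter.Tendsto.const_smul (hx hp) c

/-- Hahn–Banach for functionals on an isometrically embedded subspace. -/
theorem exists_dual_extension_of_isometry {𝕜 : Type*} [RCLike 𝕜] {Y Z : Type*}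
    [NormedAddCommGroup Y] [NormedSpace 𝕜 Y] [NormedAddCommGroup Z] [NormedSpace 𝕜 Z]
    (j : Y →ₗᵢ[𝕜] Z) (f : StrongDual 𝕜 Y) :
    ∃ g : StrongDual 𝕜 Z, (∀ y, g (j y) = f y) ∧ ‖g‖ = ‖f‖ := by
  let e := j.equivRange
  obtain ⟨g, hg, hgn⟩ := exists_extension_norm_eq (LinearMap.range j.toLinearMap)
    (f.comp (e.symm.toContinuousLinearEquiv : _ →L[𝕜] Y))
  refine ⟨g, fun y => ?_, hgn.trans ?_⟩
  · have := hg (e y)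
    simpa [e] using this
  · exact ContinuousLinearMap.opNorm_comp_linearIsometryEquiv f e.symm

/-- Coordinatewise Hahn–Banach extension of a sequence in `ℓ_p^s(Y*)`. -/
theorem exists_strongSeq_extension {𝕜 : Type*} [RCLike 𝕜] {Y Z : Type*}
    [NormedAddCommGroup Y] [NormedSpace 𝕜 Y] [NormedAddCommGroup Z] [NormedSpace 𝕜 Z]
    {p : ℝ≥0∞} (hp : p ≠ 0) (j : Y →ₗᵢ[𝕜] Z) {φ : lp (fun _ : ℕ => StrongDual 𝕜 Y) p}
    (hφ : φ ∈ StrongSeq (StrongDual 𝕜 Y) p) :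
    ∃ ψ ∈ StrongSeq (StrongDual 𝕜 Z) p, (∀ n y, ψ n (j y) = φ n y) ∧ ‖ψ‖ = ‖φ‖ := by
  choose ψ hψ hn using fun n => exists_dual_extension_of_isometry j (φ n)
  let ψ' : lp (fun _ : ℕ => StrongDual 𝕜 Z) p :=
    ⟨ψ, (lp.memℓp φ).norm.mono fun n => (hn n).le⟩
  exact ⟨ψ', StrongSeq.congr_norm hφ hn, hψ, le_antisymm (lp.norm_mono hp fun n => (hn n).le)
    (lp.norm_mono hp fun n => (hn n).ge)⟩

/-! ### Extension of operators -/

/-- For `A : ℓ_p → X` and `f ∈ X*` the adjoint of `z ↦ A (ψ_n z)_n` sends `f` to `∑ β_n ψ_n`, where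
`β_n` is the value of `f ∘ A` at the `n`-th unit vector. -/
theorem dualOp_comp_evalSeq_subset_ballImage {𝕜 : Type*} [RCLike 𝕜] {p : ℝ≥0∞} [Fact (1 ≤ p)]
    {X Z : Type*} [NormedAddCommGroup X] [NormedSpace 𝕜 X] [NormedAddCommGroup Z] [NormedSpace 𝕜 Z]
    {ψ : lp (fun _ : ℕ => StrongDual 𝕜 Z) p} (hψ : ψ ∈ StrongSeq (StrongDual 𝕜 Z) p)
    (A : lp (fun _ : ℕ => 𝕜) p →L[𝕜] X) {c : ℝ} (hc : 0 < c) (hA : ‖A‖ ≤ c) :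
    dualOp (A.comp (evalSeq ψ)) '' Metric.closedBall 0 1 ⊆ ballImage 𝕜 p ((c : 𝕜) • ψ) := by
  rintro _ ⟨f, hf, rfl⟩
  rw [mem_closedBall_zero_iff] at hf
  have hpq : p.HolderConjugate p.conjExponent := .conjExponent Fact.out
  have : Fact (1 ≤ p.conjExponent) := ⟨hpq.symm.one_le⟩
  have hc' : (c : 𝕜) ≠ 0 := RCLike.ofReal_ne_zero.2 hc.ne'
  obtain ⟨β, hβ, hβn⟩ := exists_lp_coeff_of_dual (q := p.conjExponent) (f.comp A)
  have hβc : ‖β‖ ≤ c := by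
    refine hβ.trans ((f.opNorm_comp_le A).trans ?_)
    nlinarith [norm_nonneg A]
  refine ⟨(c : 𝕜)⁻¹ • β, ?_, ?_⟩
  · rw [norm_smul, norm_inv, RCLike.norm_ofReal, abs_of_pos hc, inv_mul_le_iff₀ hc, mul_one]
    exact hβc
  have hterm : (fun n => ((c : 𝕜)⁻¹ • β) n • ((c : 𝕜) • ψ) n) = fun n => β n • ψ n := by
    funext n
    simp only [lp.coeFn_smul, Pi.smul_apply, smul_eq_mul, smul_smul]
    rw [mul_right_comm, inv_mul_cancel₀ hc', one_mul]
  rw [hterm]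
  -- Hölder's inequality gives convergence in norm; the sum is then identified pointwise.
  have hsum : Summable fun n => β n • ψ n := by
    have : p.conjExponent.HolderConjugate p := hpq.symm
    have h := (lp.memℓp β).holder 1 (lp.memℓp ψ)
      (fun _ => ContinuousLinearMap.lsmul 𝕜 𝕜) (K := 1)
      fun _ => ContinuousLinearMap.opNorm_lsmul_le
    exact h.summable_of_one
  obtain ⟨h, hh⟩ := hsum
  suffices h = dualOp (A.comp (evalSeq ψ)) f from this ▸ hh
  ext z
  have h1 : HasSum (fun n => (β n • ψ n) z) (h z) :=
    hh.mapL (ContinuousLinearMap.apply 𝕜 𝕜 z)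
  have h2 : HasSum (fun n => (lp.single p n (evalSeq ψ z n) : lp (fun _ : ℕ => 𝕜) p))
      (evalSeq ψ z) := by
    refine lp_hasSum_single_of_tendsto _ fun hp => ?_
    have := ((ContinuousLinearMap.apply 𝕜 𝕜 z).continuous.tendsto 0).comp (hψ hp)
    simpa [Function.comp_def] using this
  have h3 := h2.mapL (f.comp A)
  refine h1.unique ?_
  convert h3 using 2 with n
  have : (lp.single p n (evalSeq ψ z n) : lp (fun _ : ℕ => 𝕜) p)
      = (evalSeq ψ z n) • lp.single p n 1 := by
    rw [← lp.single_smul, smul_eq_mul, mul_one]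
  · rw [this, map_smul, ← hβn]
    simp [mul_comm]
  · rfl

theorem kappa_le_of_subset_ballImage {𝕜 : Type*} [RCLike 𝕜] {X Y : Type*} [NormedAddCommGroup X]
    [NormedSpace 𝕜 X] [NormedAddCommGroup Y] [NormedSpace 𝕜 Y] {p : ℝ≥0∞} {T : X →L[𝕜] Y}
    {y : lp (fun _ : ℕ => Y) p} (hy : y ∈ StrongSeq Y p)
    (h : T '' Metric.closedBall 0 1 ⊆ ballImage 𝕜 p y) : kappa p T ≤ ‖y‖ :=
  csInf_le ⟨0, by rintro _ ⟨y, -, -, rfl⟩; exact lp.norm_nonneg' y⟩ ⟨y, hy, h, rfl⟩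

theorem exists_norm_lt_of_kappa_lt {𝕜 : Type*} [RCLike 𝕜] {X Y : Type*} [NormedAddCommGroup X]
    [NormedSpace 𝕜 X] [NormedAddCommGroup Y] [NormedSpace 𝕜 Y] {p : ℝ≥0∞} {T : X →L[𝕜] Y}
    (hT : IsPCompactOp p T) {r : ℝ} (hr : kappa p T < r) :
    ∃ y ∈ StrongSeq Y p, T '' Metric.closedBall 0 1 ⊆ ballImage 𝕜 p y ∧ ‖y‖ < r := by
  obtain ⟨y₀, hy₀, h₀⟩ := hT
  obtain ⟨_, ⟨y, hy, h, rfl⟩, hlt⟩ := exists_lt_of_csInf_lt (by exact ⟨_, y₀, hy₀, h₀, rfl⟩) hr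
  exact ⟨y, hy, h, hlt⟩

/-- An operator `T` into a `P_lam`-space for which `T*` maps the unit ball into `E_φ(B_{ℓ_q})` has an
extension whose dual ideal norm is at most `lam * ‖φ‖`. -/
theorem exists_extension_of_dualOp_subset_ballImage {𝕜 : Type*} [RCLike 𝕜] {p : ℝ≥0∞} (hp : 1 ≤ p)
    {lam : ℝ} (hlam : 0 < lam) {X : Type*} [NormedAddCommGroup X] [NormedSpace 𝕜 X]
    (hX : IsPSpace 𝕜 lam X) {Y Z : Type*} [NormedAddCommGroup Y] [NormedSpace 𝕜 Y]
    [NormedAddCommGroup Z] [NormedSpace 𝕜 Z] {T : Y →L[𝕜] X} (j : Y →ₗᵢ[𝕜] Z)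
    {φ : lp (fun _ : ℕ => StrongDual 𝕜 Y) p} (hφ : φ ∈ StrongSeq (StrongDual 𝕜 Y) p)
    (hT : dualOp T '' Metric.closedBall 0 1 ⊆ ballImage 𝕜 p φ) :
    ∃ T' : Z →L[𝕜] X, (∀ y, T' (j y) = T y) ∧ IsDualPCompactOp p T' ∧
      kappaDual p T' ≤ lam * ‖φ‖ := by
  have : Fact (1 ≤ p) := ⟨hp⟩
  have hpq : p.conjExponent.HolderConjugate p := (ENNReal.HolderConjugate.conjExponent hp).symm
  have : Fact (1 ≤ p.conjExponent) := ⟨hpq.one_le⟩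
  have hp0 : p ≠ 0 := (zero_lt_one.trans_le hp).ne'
  obtain ⟨ψ, hψ, hψφ, hnorm⟩ := exists_strongSeq_extension hp0 j hφ
  obtain ⟨P, hP, hPn⟩ := hX _ (dualBallEmbedding 𝕜 X)
  choose α hα hsum using fun f : Metric.closedBall (0 : StrongDual 𝕜 X) 1 =>
    hT ⟨f.1, f.2, rfl⟩
  let D := lp.dualPairing (ι := ℕ) (H := 𝕜) p.conjExponent p
    (fun _ => ContinuousLinearMap.mul 𝕜 𝕜) (K := 1) fun _ => by
      simp
  have hD : ‖D‖ ≤ 1 := by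
    simpa using lp.norm_dualPairing (p := p.conjExponent) (q := p) (ι := ℕ) (H := 𝕜)
      (fun _ => ContinuousLinearMap.mul 𝕜 𝕜) (K := 1) fun _ => by
        simp
  let R := toLinfty (fun f => D (α f)) fun f => by
    simpa using D.le_of_opNorm_le_of_le hD (hα f)
  have hA : ‖P.comp R‖ ≤ lam := by
    refine (P.opNorm_comp_le R).trans ?_
    have := norm_toLinfty_le (fun f => D (α f)) fun f => by
      simpa using D.le_of_opNorm_le_of_le hD (hα f)
    exact (mul_le_mul hPn this (norm_nonneg _) hlam.le).trans_eq (mul_one _)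
  have hmem : (lam : 𝕜) • ψ ∈ StrongSeq (StrongDual 𝕜 Z) p :=
    StrongSeq.const_smul hψ _
  have hsub := dualOp_comp_evalSeq_subset_ballImage hψ (P.comp R) hlam hA
  refine ⟨(P.comp R).comp (evalSeq ψ), fun y => ?_, ⟨_, hmem, hsub⟩, ?_⟩
  · have hR : R (evalSeq ψ (j y)) = dualBallEmbedding 𝕜 X (T y) := by
      ext f
      have h1 : HasSum (fun n => α f n * φ n y) (f.1 (T y)) :=
        (hsum f).mapL (ContinuousLinearMap.apply 𝕜 𝕜 y)
      rw [dualBallEmbedding_apply, ← h1.tsum_eq]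
      change D (α f) (evalSeq ψ (j y)) = _
      refine (lp.dualPairing_apply _ _ _ _).trans (tsum_congr fun n => ?_)
      rw [evalSeq_apply, hψφ, ContinuousLinearMap.mul_apply']
    rw [ContinuousLinearMap.comp_apply, ContinuousLinearMap.comp_apply, hR, hP]
  · refine (kappa_le_of_subset_ballImage hmem hsub).trans_eq ?_
    rw [norm_smul, RCLike.norm_ofReal, abs_of_pos hlam, hnorm]

/-- The operator norm is dominated by the norm of every sequence admissible for `κ_p`. -/
theorem norm_le_of_subset_ballImage {𝕜 : Type*} [RCLike 𝕜] {X Y : Type*} [NormedAddCommGroup X]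
    [NormedSpace 𝕜 X] [NormedAddCommGroup Y] [NormedSpace 𝕜 Y] [CompleteSpace Y] {p : ℝ≥0∞}
    (hp : 1 ≤ p) {T : X →L[𝕜] Y} {y : lp (fun _ : ℕ => Y) p}
    (h : T '' Metric.closedBall 0 1 ⊆ ballImage 𝕜 p y) {x : X} (hx : ‖x‖ ≤ 1) :
    ‖T x‖ ≤ ‖y‖ := by
  have : Fact (1 ≤ p) := ⟨hp⟩
  have hpq : p.conjExponent.HolderConjugate p := (ENNReal.HolderConjugate.conjExponent hp).symm
  have : Fact (1 ≤ p.conjExponent) := ⟨hpq.one_le⟩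
  obtain ⟨α, hα, hs⟩ := h ⟨x, mem_closedBall_zero_iff.2 hx, rfl⟩
  have hB : ∀ _ : ℕ, ‖(ContinuousLinearMap.lsmul 𝕜 𝕜 : 𝕜 →L[𝕜] Y →L[𝕜] Y)‖ ≤ (1 : NNReal) :=
    fun _ => ContinuousLinearMap.opNorm_lsmul_le
  have hTx : lp.dualPairing p.conjExponent p _ hB α y = T x := hs.tsum_eq
  have h1 := (lp.dualPairing p.conjExponent p _ hB).le_of_opNorm_le_of_le
    (lp.norm_dualPairing _ hB) hα
  rw [← hTx]
  simpa using ContinuousLinearMap.le_of_opNorm_le _ h1 y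

theorem eq_zero_of_kappaDual_eq_zero {𝕜 : Type*} [RCLike 𝕜] {X Y : Type*} [NormedAddCommGroup X]
    [NormedSpace 𝕜 X] [NormedAddCommGroup Y] [NormedSpace 𝕜 Y] {p : ℝ≥0∞} (hp : 1 ≤ p)
    {T : Y →L[𝕜] X} (hT : IsDualPCompactOp p T) (h0 : kappaDual p T = 0) : T = 0 := by
  ext y
  obtain ⟨f, hf, hfx⟩ := exists_dual_vector'' 𝕜 (T y)
  have hz : dualOp T f = 0 := by
    rw [← norm_le_zero_iff]
    refine le_of_forall_gt_imp_ge_of_dense fun r hr => ?_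
    obtain ⟨φ, -, hsub, hlt⟩ := exists_norm_lt_of_kappa_lt hT (h0.trans_lt hr)
    exact (norm_le_of_subset_ballImage hp hsub hf).trans hlt.le
  have hfy : f (T y) = 0 := DFunLike.congr_fun hz y
  rw [hfx] at hfy
  simpa using hfy

theorem zero_subset_ballImage_zero {𝕜 : Type*} [RCLike 𝕜] {X Y : Type*} [NormedAddCommGroup X]
    [NormedSpace 𝕜 X] [NormedAddCommGroup Y] [NormedSpace 𝕜 Y] {p : ℝ≥0∞} :
    (0 : X →L[𝕜] Y) '' Metric.closedBall 0 1 ⊆ ballImage 𝕜 p 0 := by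
  rintro _ ⟨x, -, rfl⟩
  refine ⟨0, ?_, ?_⟩
  · rw [lp.norm_zero]; exact zero_le_one
  · simp

theorem mainTheorem10 {𝕜 : Type*} [RCLike 𝕜] {p : ℝ≥0∞} (hp : 1 ≤ p)
    {lam : ℝ} (hlam : 1 ≤ lam)
    {X : Type*} [NormedAddCommGroup X] [NormedSpace 𝕜 X] [CompleteSpace X]
    (hX : IsPSpace 𝕜 lam X)
    {Y : Type*} [NormedAddCommGroup Y] [NormedSpace 𝕜 Y] [CompleteSpace Y]
    {T : Y →L[𝕜] X} (hT : IsDualPCompactOp p T)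
    {Z : Type*} [NormedAddCommGroup Z] [NormedSpace 𝕜 Z] [CompleteSpace Z]
    (j : Y →ₗᵢ[𝕜] Z) {ε : ℝ} (hε : 0 < ε) :
    ∃ T' : Z →L[𝕜] X, (∀ y, T' (j y) = T y) ∧ IsDualPCompactOp p T' ∧
      kappaDual p T' ≤ (lam + ε) * kappaDual p T := by
  have hlam0 : 0 < lam := zero_lt_one.trans_le hlam
  have hk : 0 ≤ kappaDual p T :=
    Real.sInf_nonneg (by rintro _ ⟨φ, -, -, rfl⟩; exact lp.norm_nonneg' φ)
  rcases hk.eq_or_lt with h0 | hpos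
  · obtain rfl := eq_zero_of_kappaDual_eq_zero hp hT h0.symm
    have hd : dualOp (0 : Z →L[𝕜] X) = 0 := by
      ext f z
      simp [dualOp]
    have hmem : (0 : lp (fun _ : ℕ => StrongDual 𝕜 Z) p) ∈ StrongSeq (StrongDual 𝕜 Z) p :=
      fun _ => by simp
    have hsub : dualOp (0 : Z →L[𝕜] X) '' Metric.closedBall 0 1 ⊆ ballImage 𝕜 p 0 := by
      rw [hd]; exact zero_subset_ballImage_zero
    refine ⟨0, fun y => rfl, ⟨0, hmem, hsub⟩, ?_⟩
    rw [← h0, mul_zero]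
    exact (kappa_le_of_subset_ballImage hmem hsub).trans_eq lp.norm_zero
  · have hlt : kappaDual p T < (lam + ε) / lam * kappaDual p T :=
      lt_mul_of_one_lt_left hpos ((one_lt_div hlam0).2 (lt_add_of_pos_right _ hε))
    obtain ⟨φ, hφ, hsub, hφlt⟩ := exists_norm_lt_of_kappa_lt hT hlt
    obtain ⟨T', hT', hc, hk'⟩ := exists_extension_of_dualOp_subset_ballImage hp hlam0 hX j hφ hsub
    refine ⟨T', hT', hc, hk'.trans ?_⟩
    calc lam * ‖φ‖ ≤ lam * ((lam + ε) / lam * kappaDual p T) := by gcongr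
      _ = (lam + ε) * kappaDual p T := by field_simp
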